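/- Let $n\ge 0$, $f\colon\{0,1\}^n\times\{0,1\}^n\to\{0,1\}$ and $\epsilon\in[0,1/2]$. Let $R_\epsilon(f)$ be the public-coin randomized communication complexity of $f$: the least $k$ such that some probability distribution on deterministic two-party protocols (binary protocol trees whose leaves carry the output), each with transcripts of at most $k$ bits, errs with probability at most $\epsilon$ on every input. For $h\colon\{0,1\}^n\times\{0,1\}^n\to\{0,1\}$ and a probability distribution $\mu$ on $\{0,1\}^n\times\{0,1\}^n$, let $\beta^*(h,\mu)$ be the supremum of the bias $2\Pr[\text{win}]-1$ over all quantum strategies for the XOR game $(h,\mu)$: the players share a finite-dimensional bipartite quantum state, receive $x$ and $y$ respectively with $(x,y)\sim\mu$, do not communicate, answer bits $a$ and $b$ by local measurements, and win if and only if $a\oplus b=h(x,y)$. Then $\beta^*(h,\mu)>0$ for all $h,\mu$, the maximum below exists, it is positive if $\epsilon<1/2$, and $$R_\epsilon(f)\ \ge\ 2\log_2\max_{h,\mu}\frac{(1-\epsilon)\,\mathbb{E}_{(x,y)\sim\mu}[f(x,y)h(x,y)]-\epsilon}{\beta^*(h,\mu)},$$ where the maximum is over all $h\colon\{0,1\}^n\times\{0,1\}^n\to\{0,1\}$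 and all probability distributions $\mu$ on $\{0,1\}^n\times\{0,1\}^n$, and in the expectation the values $0,1$ of $f$ and $h$ are read as $+1,-1$. (For $\epsilon=1/2$ the maximum is $0$ and the bound is void: $R_\epsilon(f)\ge0$.) -/

import Mathlib

/-- The input set `{0,1}^n` of one player. -/
abbrev Bits (n : ℕ) : Type := Fin n → Bool

/-- The real number `+1` for the bit `0` and `-1` for the bit `1`. -/
def bitSign (b : Bool) : ℝ := if b then -1 else 1

/-- `𝔼_{(x,y) ∼ μ} [f(x,y) h(x,y)]`, the bits `0, 1` being read as `+1, -1`. -/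
def correlation {X Y : Type} [Fintype X] [Fintype Y] (f h : X × Y → Bool) (μ : X × Y → ℝ) : ℝ :=
  ∑ p, μ p * (bitSign (f p) * bitSign (h p))

/-! ### Communication protocols -/

/-- A deterministic two-party communication protocol, as a binary tree: at an inner node
the player who owns the node sends one bit, computed from her or his own input, and the
bit selects the child (`P₀` on `0`, `P₁` on `1`); a leaf carries the output. -/
inductive Protocol (X Y : Type) : Type
  | output (b : Bool) : Protocol X Y
  | alice (msg : X → Bool) (P₀ P₁ : Protocol X Y) : Protocol X Y
  | bob (msg : Y → Bool) (P₀ P₁ : Protocol X Y) : Protocol X Y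

/-- The output of a protocol on the input `(x, y)`. -/
def Protocol.run {X Y : Type} : Protocol X Y → X → Y → Bool
  | .output b, _, _ => b
  | .alice msg P₀ P₁, x, y => if msg x then P₁.run x y else P₀.run x y
  | .bob msg P₀ P₁, x, y => if msg y then P₁.run x y else P₀.run x y

/-- The cost of a protocol: the length of its longest transcript, in bits. -/
def Protocol.cost {X Y : Type} : Protocol X Y → ℕ
  | .output _ => 0
  | .alice _ P₀ P₁ => max P₀.cost P₁.cost + 1
  | .bob _ P₀ P₁ => max P₀.cost P₁.cost + 1

/-- `f` can be computed with public randomness and at most `k` bits of communication (in the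
worst case), with error probability at most `ε` on every input: a randomized protocol is a
probability distribution on deterministic ones. -/
def RandomizedComputable {X Y : Type} (ε : ℝ) (f : X × Y → Bool) (k : ℕ) : Prop :=
  ∃ q : PMF (Protocol X Y), (∀ P ∈ q.support, P.cost ≤ k) ∧
    ∀ x y, q.toOuterMeasure {P | P.run x y ≠ f (x, y)} ≤ ENNReal.ofReal ε

/-- The (public-coin) randomized communication complexity `R_ε(f)`. -/
noncomputable def randomizedCC {X Y : Type} (ε : ℝ) (f : X × Y → Bool) : ℕ :=
  sInf {k | RandomizedComputable ε f k}

/-! ### Quantum strategies for XOR games -/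

open scoped ComplexOrder in
/-- A quantum strategy of two players without communication: a shared bipartite state
(a density matrix on `ℂ^ι ⊗ ℂ^κ`) and, for each input of each player, a two-outcome
measurement (POVM) on the player's own part of the state. -/
structure QuantumStrategy (X Y ι κ : Type) [Fintype ι] [DecidableEq ι]
    [Fintype κ] [DecidableEq κ] where
  /-- the shared state -/
  state : Matrix (ι × κ) (ι × κ) ℂ
  state_posSemidef : state.PosSemidef
  state_trace : state.trace = 1
  /-- Alice's measurement operators, for input `x` and outcome `a` -/
  alice : X → Bool → Matrix ι ι ℂ
  alice_posSemidef : ∀ x a, (alice x a).PosSemidef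
  alice_sum : ∀ x, ∑ a, alice x a = 1
  /-- Bob's measurement operators, for input `y` and outcome `b` -/
  bob : Y → Bool → Matrix κ κ ℂ
  bob_posSemidef : ∀ y b, (bob y b).PosSemidef
  bob_sum : ∀ y, ∑ b, bob y b = 1

open scoped Kronecker in
/-- The probability `Pr(a, b | x, y) = tr (ρ (A_{x,a} ⊗ B_{y,b}))` of the answers `a, b`. -/
noncomputable def QuantumStrategy.prob {X Y ι κ : Type} [Fintype ι] [DecidableEq ι]
    [Fintype κ] [DecidableEq κ] (S : QuantumStrategy X Y ι κ) (x : X) (y : Y) (a b : Bool) : ℝ :=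
  (S.state * (S.alice x a ⊗ₖ S.bob y b)).trace.re

/-- The probability that the strategy wins the XOR game `(h, μ)`: `a ⊕ b = h(x,y)`. -/
noncomputable def QuantumStrategy.winProb {X Y ι κ : Type} [Fintype X] [Fintype Y]
    [Fintype ι] [DecidableEq ι] [Fintype κ] [DecidableEq κ] (S : QuantumStrategy X Y ι κ)
    (h : X × Y → Bool) (μ : X × Y → ℝ) : ℝ :=
  ∑ p : X × Y, μ p * ∑ a, ∑ b, if xor a b = h p then S.prob p.1 p.2 a b else 0

/-- `β*(h, μ)`: the supremum, over all finite-dimensional shared quantum states and all local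
measurements, of the bias `2 Pr(win) - 1` in the XOR game `(h, μ)`. -/
noncomputable def quantumBias {X Y : Type} [Fintype X] [Fintype Y]
    (h : X × Y → Bool) (μ : X × Y → ℝ) : ℝ :=
  sSup {β | ∃ (ι κ : Type) (_ : Fintype ι) (_ : DecidableEq ι) (_ : Fintype κ)
    (_ : DecidableEq κ) (S : QuantumStrategy X Y ι κ), β = 2 * S.winProb h μ - 1}

open scoped ComplexOrder Kronecker

/-! ### Signs and correlations -/

/-! Vectors link communication to XOR games. The sign matrix of a deterministic protocol of cost c
factors as inner products ⟨u x, v y⟩ with |u x| ≤ 1 and |v y|² ≤ 2^c (`Protocol.exists_vectors`).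
Once v is divided by 2^(c/2), Tsirelson's construction realizes the inner products as quantum
correlations (`sum_inner_le_quantumBias`). Hence the protocol's correlation with h under μ is at
most 2^(c/2) β*(h, μ) (`Protocol.correlation_le`). Conversely, averaging over the public coins
yields a deterministic protocol whose correlation with h is at least (1-ε) 𝔼[f h] - ε
(`RandomizedComputable.exists_correlation_ge`). Comparing the two and taking logarithms gives the
bound. The maximum exists because there are finitely many h, the simplex is compact, and β* is
continuous and positive on it (`continuousOn_quantumBias`, `quantumBias_pos`). -/

lemma bitSign_true : bitSign true = -1 := by simp [bitSign]

lemma bitSign_false : bitSign false = 1 := by simp [bitSign]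

lemma bitSign_mul_self (b : Bool) : bitSign b * bitSign b = 1 := by
  cases b <;> simp [bitSign]

lemma bitSign_sq (b : Bool) : bitSign b ^ 2 = 1 := by
  rw [sq, bitSign_mul_self]

lemma correlation_self {X Y : Type} [Fintype X] [Fintype Y] (f : X × Y → Bool) {μ : X × Y → ℝ}
    (hμ : μ ∈ stdSimplex ℝ (X × Y)) : correlation f f μ = 1 := by
  simp [correlation, bitSign_mul_self, hμ.2]

/-! ### The bias of a quantum strategy -/

open scoped MatrixOrder Matrix.Norms.L2Operator in
lemma Matrix.PosSemidef.trace_mul_nonneg {ι : Type*} [Fintype ι] [DecidableEq ι]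
    {A B : Matrix ι ι ℂ} (hA : A.PosSemidef) (hB : B.PosSemidef) : 0 ≤ (A * B).trace := by
  obtain ⟨C, rfl⟩ := CStarAlgebra.nonneg_iff_eq_star_mul_self.mp hA.nonneg
  rw [Matrix.star_eq_conjTranspose, Matrix.mul_assoc, Matrix.trace_mul_comm]
  exact (hB.mul_mul_conjTranspose_same C).trace_nonneg

namespace QuantumStrategy

variable {X Y ι κ : Type} [Fintype ι] [DecidableEq ι] [Fintype κ] [DecidableEq κ]

lemma prob_nonneg (S : QuantumStrategy X Y ι κ) (x : X) (y : Y) (a b : Bool) :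
    0 ≤ S.prob x y a b :=
  (Complex.nonneg_iff.mp (S.state_posSemidef.trace_mul_nonneg
    ((S.alice_posSemidef x a).kronecker (S.bob_posSemidef y b)))).1

lemma sum_prob (S : QuantumStrategy X Y ι κ) (x : X) (y : Y) :
    ∑ a, ∑ b, S.prob x y a b = 1 := by
  have h : ∑ a, ∑ b, S.state * (S.alice x a ⊗ₖ S.bob y b) = S.state := by
    have h1 := S.alice_sum x
    have h2 := S.bob_sum y
    simp only [Fintype.sum_bool] at h1 h2 ⊢
    simp only [← Matrix.mul_add, ← Matrix.kronecker_add, ← Matrix.add_kronecker, h1, h2,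
      Matrix.one_kronecker_one, Matrix.mul_one]
  have h' := congrArg (fun M => (Matrix.trace M).re) h
  simp only [Matrix.trace_sum, Complex.re_sum, S.state_trace, Complex.one_re] at h'
  exact h'

/-- The expected value of `(-1) ^ (a ⊕ b ⊕ c)` on the input `p`. -/
noncomputable def score (S : QuantumStrategy X Y ι κ) (c : Bool) (p : X × Y) : ℝ :=
  2 * (∑ a, ∑ b, if xor a b = c then S.prob p.1 p.2 a b else 0) - 1

lemma abs_score_le_one (S : QuantumStrategy X Y ι κ) (c : Bool) (p : X × Y) :
    |S.score c p| ≤ 1 := by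
  have h0 := S.prob_nonneg p.1 p.2
  have h1 := S.sum_prob p.1 p.2
  have hff := h0 false false
  have hft := h0 false true
  have htf := h0 true false
  have htt := h0 true true
  simp only [Fintype.sum_bool] at h1
  rw [abs_le]
  cases c <;> simp [score] <;> constructor <;> linarith

lemma two_mul_winProb_sub_one [Fintype X] [Fintype Y] (S : QuantumStrategy X Y ι κ)
    (h : X × Y → Bool) {μ : X × Y → ℝ} (hμ : μ ∈ stdSimplex ℝ (X × Y)) :
    2 * S.winProb h μ - 1 = ∑ p, μ p * S.score (h p) p := by
  have h1 := hμ.2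
  simp only [winProb, score, mul_sub, mul_one, Finset.sum_sub_distrib, h1, Finset.mul_sum]
  congr 1
  refine Finset.sum_congr rfl fun p _ => Finset.sum_congr rfl fun a _ =>
    Finset.sum_congr rfl fun b _ => ?_
  ring

end QuantumStrategy

section QuantumBias

variable {X Y : Type} [Fintype X] [Fintype Y]

lemma bddAbove_quantumBias (h : X × Y → Bool) {μ : X × Y → ℝ} (hμ : μ ∈ stdSimplex ℝ (X × Y)) :
    BddAbove {β | ∃ (ι κ : Type) (_ : Fintype ι) (_ : DecidableEq ι) (_ : Fintype κ)
      (_ : DecidableEq κ) (S : QuantumStrategy X Y ι κ), β = 2 * S.winProb h μ - 1} := by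
  refine ⟨1, ?_⟩
  rintro _ ⟨ι, κ, _, _, _, _, S, rfl⟩
  rw [S.two_mul_winProb_sub_one h hμ, ← hμ.2]
  exact Finset.sum_le_sum fun p _ =>
    mul_le_of_le_one_right (hμ.1 p) (abs_le.mp (S.abs_score_le_one _ _)).2

lemma le_quantumBias {ι κ : Type} [Fintype ι] [DecidableEq ι] [Fintype κ] [DecidableEq κ]
    (S : QuantumStrategy X Y ι κ) (h : X × Y → Bool) {μ : X × Y → ℝ}
    (hμ : μ ∈ stdSimplex ℝ (X × Y)) : ∑ p, μ p * S.score (h p) p ≤ quantumBias h μ := by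
  rw [← S.two_mul_winProb_sub_one h hμ]
  exact le_csSup (bddAbove_quantumBias h hμ) ⟨ι, κ, _, _, _, _, S, rfl⟩

/-- Both players measure a one-dimensional system. -/
noncomputable def QuantumStrategy.trivial (X Y : Type) : QuantumStrategy X Y Unit Unit where
  state := 1
  state_posSemidef := Matrix.PosSemidef.one
  state_trace := by simp
  alice _ a := if a then 1 else 0
  alice_posSemidef _ a := by cases a <;> simp [Matrix.PosSemidef.one, Matrix.PosSemidef.zero]
  alice_sum _ := by simp
  bob _ a := if a then 1 else 0
  bob_posSemidef _ a := by cases a <;> simp [Matrix.PosSemidef.one, Matrix.PosSemidef.zero]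
  bob_sum _ := by simp

/-- Scores lie in [-1, 1], so the bias of a fixed strategy is 1-Lipschitz in μ for the ℓ¹ distance;
the supremum inherits this. -/
lemma quantumBias_le_add (h : X × Y → Bool) {μ ν : X × Y → ℝ} (hμ : μ ∈ stdSimplex ℝ (X × Y))
    (hν : ν ∈ stdSimplex ℝ (X × Y)) :
    quantumBias h μ ≤ quantumBias h ν + ∑ p, |μ p - ν p| := by
  refine csSup_le ⟨_, Unit, Unit, _, _, _, _, QuantumStrategy.trivial X Y, rfl⟩ ?_
  rintro _ ⟨ι, κ, _, _, _, _, S, rfl⟩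
  rw [S.two_mul_winProb_sub_one h hμ]
  refine le_trans ?_ (add_le_add_left (le_quantumBias S h hν) _)
  rw [← Finset.sum_add_distrib]
  refine Finset.sum_le_sum fun p _ => ?_
  have h1 : (μ p - ν p) * S.score (h p) p ≤ |μ p - ν p| := by
    refine (le_abs_self _).trans ?_
    rw [abs_mul]
    exact mul_le_of_le_one_right (abs_nonneg _) (S.abs_score_le_one _ _)
  linarith

lemma continuousOn_quantumBias (h : X × Y → Bool) :
    ContinuousOn (quantumBias h) (stdSimplex ℝ (X × Y)) := by
  intro μ hμ
  have hlim : Filter.Tendsto (fun ν : X × Y → ℝ => ∑ p, |ν p - μ p|)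
      (nhdsWithin μ (stdSimplex ℝ (X × Y))) (nhds 0) := by
    have hc : Continuous fun ν : X × Y → ℝ => ∑ p, |ν p - μ p| := by fun_prop
    have := hc.tendsto μ
    simp only [sub_self, abs_zero, Finset.sum_const_zero] at this
    exact this.mono_left nhdsWithin_le_nhds
  rw [ContinuousWithinAt, tendsto_iff_dist_tendsto_zero]
  refine squeeze_zero' (Filter.Eventually.of_forall fun _ => dist_nonneg) ?_ hlim
  filter_upwards [self_mem_nhdsWithin] with ν hν
  have h1 := quantumBias_le_add h hμ hν
  have h2 := quantumBias_le_add h hν hμ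
  simp only [abs_sub_comm (μ _)] at h1
  rw [Real.dist_eq, abs_le]
  constructor <;> linarith

end QuantumBias

/-! ### Anticommuting observables -/

/-- A family of real symmetric matrices that square to `1` and anticommute pairwise. -/
structure IsCliffordFamily {ι δ : Type} [Fintype ι] [DecidableEq ι] [DecidableEq δ]
    (γ : δ → Matrix ι ι ℂ) : Prop where
  conjTranspose_eq : ∀ i, (γ i).conjTranspose = γ i
  transpose_eq : ∀ i, (γ i).transpose = γ i
  anticomm : ∀ i j, γ i * γ j + γ j * γ i = if i = j then 2 else 0

lemma exists_isCliffordFamily_fin (d : ℕ) :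
    ∃ (ι : Type) (_ : Fintype ι) (_ : DecidableEq ι) (_ : Nonempty ι)
      (γ : Fin d → Matrix ι ι ℂ), IsCliffordFamily γ := by
  induction d with
  | zero => exact ⟨Unit, _, _, inferInstance, Fin.elim0, ⟨fun i => i.elim0, fun i => i.elim0,
      fun i => i.elim0⟩⟩
  | succ d ih =>
    obtain ⟨ι, _, _, _, γ, hγ⟩ := ih
    let Z : Matrix (Fin 2) (Fin 2) ℂ := !![1, 0; 0, -1]
    let W : Matrix (Fin 2) (Fin 2) ℂ := !![0, 1; 1, 0]
    have hZZ : Z * Z = 1 := by simp [Z, Matrix.one_fin_two]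
    have hWW : W * W = 1 := by simp [W, Matrix.one_fin_two]
    have hWZ : W * Z = -(Z * W) := by simp [Z, W]
    have hZc : Z.conjTranspose = Z := by
      ext i j; fin_cases i <;> fin_cases j <;> simp [Z]
    have hWc : W.conjTranspose = W := by
      ext i j; fin_cases i <;> fin_cases j <;> simp [W]
    have hZt : Z.transpose = Z := by
      ext i j; fin_cases i <;> fin_cases j <;> simp [Z]
    have hWt : W.transpose = W := by
      ext i j; fin_cases i <;> fin_cases j <;> simp [W]
    -- Tensoring the old generators with Z keeps their relations; the new 1 ⊗ W anticommutes with
    -- them because W anticommutes with Z. Both factors are real symmetric, unlike the third Pauli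
    -- matrix.
    refine ⟨ι × Fin 2, inferInstance, inferInstance, inferInstance,
      Fin.cons ((1 : Matrix ι ι ℂ) ⊗ₖ W) (fun i => γ i ⊗ₖ Z), ⟨?_, ?_, ?_⟩⟩
    · refine Fin.cases ?_ fun i => ?_
      · simp [Matrix.conjTranspose_kronecker, hWc]
      · simp [Matrix.conjTranspose_kronecker, hZc, hγ.conjTranspose_eq]
    · refine Fin.cases ?_ fun i => ?_
      · simp [← Matrix.kroneckerMap_transpose, hWt]
      · simp [← Matrix.kroneckerMap_transpose, hZt, hγ.transpose_eq]
    · refine Fin.cases (Fin.cases ?_ fun j => ?_) fun i => Fin.cases ?_ fun j => ?_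
      · simp [← Matrix.mul_kronecker_mul, hWW, one_add_one_eq_two]
      · simp [← Matrix.mul_kronecker_mul, hWZ, ← Matrix.kronecker_add,
          (Fin.succ_ne_zero j).symm]
      · simp [← Matrix.mul_kronecker_mul, hWZ, ← Matrix.kronecker_add]
      · have h := hγ.anticomm i j
        simp only [Fin.cons_succ, ← Matrix.mul_kronecker_mul, hZZ, ← Matrix.add_kronecker, h,
          Fin.succ_inj]
        split_ifs
        · rw [show (2 : Matrix ι ι ℂ) = 1 + 1 from one_add_one_eq_two.symm, Matrix.add_kronecker, Matrix.one_kronecker_one,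
            one_add_one_eq_two]
        · simp

lemma exists_isCliffordFamily (δ : Type) [Fintype δ] [DecidableEq δ] :
    ∃ (ι : Type) (_ : Fintype ι) (_ : DecidableEq ι) (_ : Nonempty ι)
      (γ : δ → Matrix ι ι ℂ), IsCliffordFamily γ := by
  obtain ⟨ι, i1, i2, i3, γ, hγ⟩ := exists_isCliffordFamily_fin (Fintype.card δ)
  refine ⟨ι, i1, i2, i3, γ ∘ Fintype.equivFin δ, ⟨fun i => hγ.1 _, fun i => hγ.2 _, fun i j => ?_⟩⟩
  simpa using hγ.anticomm (Fintype.equivFin δ i) (Fintype.equivFin δ j)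

namespace IsCliffordFamily

variable {ι δ : Type} [DecidableEq ι] [Fintype δ]

/-- The observable `∑ i, u i • γ i`. -/
noncomputable def observable (γ : δ → Matrix ι ι ℂ) (u : δ → ℝ) : Matrix ι ι ℂ :=
  ∑ i, (u i : ℂ) • γ i

/-- The measurement operators of `observable γ u`. -/
noncomputable def effect (γ : δ → Matrix ι ι ℂ) (u : δ → ℝ) (a : Bool) : Matrix ι ι ℂ :=
  (1 / 2 : ℂ) • (1 + (bitSign a : ℂ) • observable γ u)

lemma sum_effect (γ : δ → Matrix ι ι ℂ) (u : δ → ℝ) : ∑ a, effect γ u a = 1 := by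
  simp only [Fintype.sum_bool, effect, bitSign_true, bitSign_false]
  module

variable [Fintype ι] [DecidableEq δ] {γ : δ → Matrix ι ι ℂ}

lemma conjTranspose_observable (hγ : IsCliffordFamily γ) (u : δ → ℝ) :
    (observable γ u).conjTranspose = observable γ u := by
  simp [observable, Matrix.conjTranspose_sum, hγ.conjTranspose_eq]

lemma transpose_observable (hγ : IsCliffordFamily γ) (u : δ → ℝ) :
    (observable γ u).transpose = observable γ u := by
  simp [observable, Matrix.transpose_sum, hγ.transpose_eq]

/-- The polarized relation gives both the trace of a product and, for u = v, the square of an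
observable. -/
lemma observable_anticomm (hγ : IsCliffordFamily γ) (u v : δ → ℝ) :
    observable γ u * observable γ v + observable γ v * observable γ u =
      ((2 * ∑ i, u i * v i : ℝ) : ℂ) • (1 : Matrix ι ι ℂ) := by
  have h1 : observable γ u * observable γ v =
      ∑ i, ∑ j, ((u i * v j : ℝ) : ℂ) • (γ i * γ j) := by
    simp only [observable, Finset.sum_mul_sum, Matrix.smul_mul, Matrix.mul_smul, smul_smul,
      Complex.ofReal_mul]
    exact Finset.sum_congr rfl fun i _ => Finset.sum_congr rfl fun j _ => by
      rw [mul_comm (v j : ℂ)]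
  have h2 : observable γ v * observable γ u =
      ∑ i, ∑ j, ((u i * v j : ℝ) : ℂ) • (γ j * γ i) := by
    rw [Finset.sum_comm]
    simp only [observable, Finset.sum_mul_sum, Matrix.smul_mul, Matrix.mul_smul, smul_smul,
      Complex.ofReal_mul]
  rw [h1, h2, ← Finset.sum_add_distrib]
  simp only [← Finset.sum_add_distrib, ← smul_add, hγ.anticomm, smul_ite, smul_zero,
    Finset.sum_ite_eq, Finset.mem_univ, if_true]
  rw [← one_add_one_eq_two]
  simp only [smul_add, Finset.sum_add_distrib, ← Finset.sum_smul, ← add_smul]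
  congr 1
  push_cast
  ring

lemma trace_observable_mul (hγ : IsCliffordFamily γ) (u v : δ → ℝ) :
    (observable γ u * observable γ v).trace = ((∑ i, u i * v i : ℝ) : ℂ) * Fintype.card ι := by
  have h := congrArg Matrix.trace (hγ.observable_anticomm u v)
  rw [Matrix.trace_add, Matrix.trace_mul_comm (observable γ v), Matrix.trace_smul,
    Matrix.trace_one, smul_eq_mul] at h
  have h2 : (2 : ℂ) * (observable γ u * observable γ v).trace =
      2 * (((∑ i, u i * v i : ℝ) : ℂ) * Fintype.card ι) := by
    rw [two_mul, h]; push_cast; ring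
  exact mul_left_cancel₀ two_ne_zero h2

lemma observable_mul_self (hγ : IsCliffordFamily γ) (u : δ → ℝ) :
    observable γ u * observable γ u = ((∑ i, u i ^ 2 : ℝ) : ℂ) • (1 : Matrix ι ι ℂ) := by
  have h := hγ.observable_anticomm u u
  rw [← two_smul ℂ, Complex.ofReal_mul, mul_smul, Complex.ofReal_ofNat] at h
  simpa only [sq] using smul_right_injective _ (two_ne_zero : (2 : ℂ) ≠ 0) h

lemma effect_posSemidef (hγ : IsCliffordFamily γ) {u : δ → ℝ} (hu : ∑ i, u i ^ 2 ≤ 1)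
    (a : Bool) : (effect γ u a).PosSemidef := by
  set O := observable γ u with hO
  set s : ℂ := (bitSign a : ℂ) with hs
  have hss : s * s = 1 := by rw [hs, ← Complex.ofReal_mul, bitSign_mul_self, Complex.ofReal_one]
  -- Since (s O)² = |u|², the effect is a square plus a multiple (1 - |u|²)/4 of the identity,
  -- nonnegative for u in the unit ball.
  have key : effect γ u a = (1 / 4 : ℂ) • ((1 + s • O).conjTranspose * (1 + s • O)) +
      (((1 - ∑ i, u i ^ 2) / 4 : ℝ) : ℂ) • (1 : Matrix ι ι ℂ) := by
    have hc : (1 + s • O).conjTranspose = 1 + s • O := by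
      simp [hs, hO, hγ.conjTranspose_observable]
    rw [hc, mul_add, add_mul, add_mul, effect]
    simp only [Matrix.smul_mul, Matrix.mul_smul, smul_smul, hss, one_mul, mul_one, one_smul,
      ← hO, ← hs]
    rw [hO, hγ.observable_mul_self u]
    push_cast
    module
  rw [key]
  refine Matrix.PosSemidef.add ?_ ?_
  · refine (Matrix.posSemidef_conjTranspose_mul_self _).smul ?_
    rw [show (1 / 4 : ℂ) = ((1 / 4 : ℝ) : ℂ) by push_cast; rfl]
    exact Complex.zero_le_real.mpr (by norm_num)
  · exact Matrix.PosSemidef.one.smul (Complex.zero_le_real.mpr (by linarith))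

end IsCliffordFamily

/-! ### The maximally entangled state -/

/-- The unnormalized maximally entangled vector. -/
def entangledVec (ι : Type) [DecidableEq ι] : ι × ι → ℂ := fun p => if p.1 = p.2 then 1 else 0

/-- The transpose on Bob's side is the reason for requiring symmetric generators. -/
lemma trace_entangled_mul_kronecker {ι : Type} [Fintype ι] [DecidableEq ι]
    (A B : Matrix ι ι ℂ) :
    (Matrix.vecMulVec (entangledVec ι) (star (entangledVec ι)) * (A ⊗ₖ B)).trace =
      (A * B.transpose).trace := by
  have hstar : star (entangledVec ι) = entangledVec ι := by
    ext p; simp only [entangledVec, Pi.star_apply]; split_ifs <;> simp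
  rw [hstar, Matrix.trace_mul_comm, Matrix.mul_vecMulVec, Matrix.trace_vecMulVec]
  simp only [dotProduct, Matrix.mulVec, Fintype.sum_prod_type, entangledVec, Matrix.trace,
    Matrix.diag, Matrix.mul_apply, Matrix.transpose_apply, Matrix.kronecker_apply]
  simp

section VectorStrategy

open IsCliffordFamily

variable {X Y δ ι : Type} [Fintype δ] [DecidableEq δ] [Fintype ι] [DecidableEq ι] [Nonempty ι]
  {γ : δ → Matrix ι ι ℂ}

/-- Tsirelson's strategy: measure the observables of the vectors `u x` and `v y` on a
maximally entangled state. -/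
noncomputable def IsCliffordFamily.strategy (hγ : IsCliffordFamily γ) {u : X → δ → ℝ}
    {v : Y → δ → ℝ} (hu : ∀ x, ∑ i, u x i ^ 2 ≤ 1) (hv : ∀ y, ∑ i, v y i ^ 2 ≤ 1) :
    QuantumStrategy X Y ι ι where
  state := (((Fintype.card ι : ℝ)⁻¹ : ℝ) : ℂ) •
    Matrix.vecMulVec (entangledVec ι) (star (entangledVec ι))
  state_posSemidef := (Matrix.posSemidef_vecMulVec_self_star _).smul
    (Complex.zero_le_real.mpr (by positivity))
  state_trace := by
    have h := trace_entangled_mul_kronecker (1 : Matrix ι ι ℂ) 1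
    simp only [Matrix.one_kronecker_one, Matrix.mul_one, Matrix.transpose_one,
      Matrix.trace_one] at h
    rw [Matrix.trace_smul, h, smul_eq_mul]
    push_cast
    exact inv_mul_cancel₀ (by simp)
  alice x a := effect γ (u x) a
  alice_posSemidef x a := effect_posSemidef hγ (hu x) a
  alice_sum x := sum_effect γ (u x)
  bob y b := effect γ (v y) b
  bob_posSemidef y b := effect_posSemidef hγ (hv y) b
  bob_sum y := sum_effect γ (v y)

lemma IsCliffordFamily.sum_prob_strategy (hγ : IsCliffordFamily γ) {u : X → δ → ℝ}
    {v : Y → δ → ℝ} (hu : ∀ x, ∑ i, u x i ^ 2 ≤ 1) (hv : ∀ y, ∑ i, v y i ^ 2 ≤ 1)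
    (x : X) (y : Y) :
    ∑ a, ∑ b, bitSign a * bitSign b * (hγ.strategy hu hv).prob x y a b =
      ∑ i, u x i * v y i := by
  set S := hγ.strategy hu hv
  have hsum (w : δ → ℝ) : ∑ a, (bitSign a : ℂ) • effect γ w a = observable γ w := by
    simp only [Fintype.sum_bool, effect, bitSign_true, bitSign_false]
    push_cast
    module
  have h1 : ∑ a, ∑ b, bitSign a * bitSign b * S.prob x y a b =
      (S.state * (observable γ (u x) ⊗ₖ observable γ (v y))).trace.re := by
    rw [← hsum (u x), ← hsum (v y)]
    have hA : S.alice x = effect γ (u x) := rfl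
    have hB : S.bob y = effect γ (v y) := rfl
    simp only [QuantumStrategy.prob, hA, hB, Fintype.sum_bool, Matrix.add_kronecker,
      Matrix.kronecker_add, Matrix.smul_kronecker, Matrix.kronecker_smul, Matrix.mul_add,
      Matrix.mul_smul, Matrix.trace_add, Matrix.trace_smul, smul_eq_mul, Complex.add_re,
      Complex.re_ofReal_mul]
    ring
  have h2 : S.state = (((Fintype.card ι : ℝ)⁻¹ : ℝ) : ℂ) •
    Matrix.vecMulVec (entangledVec ι) (star (entangledVec ι)) := rfl
  rw [h1, h2, Matrix.smul_mul, Matrix.trace_smul, trace_entangled_mul_kronecker,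
    hγ.transpose_observable, hγ.trace_observable_mul, smul_eq_mul, Complex.re_ofReal_mul,
    Complex.re_ofReal_mul, Complex.natCast_re]
  have : (Fintype.card ι : ℝ) ≠ 0 := by simp
  field_simp

end VectorStrategy

/-! ### From vectors to the quantum bias -/

lemma QuantumStrategy.score_eq {X Y ι κ : Type} [Fintype ι] [DecidableEq ι] [Fintype κ]
    [DecidableEq κ] (S : QuantumStrategy X Y ι κ) (c : Bool) (p : X × Y) :
    S.score c p =
      bitSign c * ∑ a, ∑ b, bitSign a * bitSign b * S.prob p.1 p.2 a b := by
  have h1 := S.sum_prob p.1 p.2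
  simp only [Fintype.sum_bool] at h1
  cases c <;> simp [score, bitSign] <;> linarith

/-- Tsirelson's theorem, the direction from vectors to strategies. -/
lemma sum_inner_le_quantumBias {X Y δ : Type} [Fintype X] [Fintype Y] [Fintype δ]
    (h : X × Y → Bool) {μ : X × Y → ℝ} (hμ : μ ∈ stdSimplex ℝ (X × Y)) {u : X → δ → ℝ}
    {v : Y → δ → ℝ} (hu : ∀ x, ∑ i, u x i ^ 2 ≤ 1) (hv : ∀ y, ∑ i, v y i ^ 2 ≤ 1) :
    ∑ p, μ p * (bitSign (h p) * ∑ i, u p.1 i * v p.2 i) ≤ quantumBias h μ := by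
  classical
  obtain ⟨ι, _, _, _, γ, hγ⟩ := exists_isCliffordFamily δ
  refine le_trans (le_of_eq ?_) (le_quantumBias (hγ.strategy hu hv) h hμ)
  refine Finset.sum_congr rfl fun p _ => ?_
  rw [QuantumStrategy.score_eq, hγ.sum_prob_strategy]

lemma quantumBias_pos {X Y : Type} [Fintype X] [Fintype Y] (h : X × Y → Bool) {μ : X × Y → ℝ}
    (hμ : μ ∈ stdSimplex ℝ (X × Y)) : 0 < quantumBias h μ := by
  classical
  have hsq : ∑ p, μ p ^ 2 ≤ 1 := by
    rw [← hμ.2]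
    refine Finset.sum_le_sum fun p _ => ?_
    have h1 : μ p ≤ 1 := hμ.2 ▸ Finset.single_le_sum (fun q _ => hμ.1 q) (Finset.mem_univ p)
    nlinarith [hμ.1 p]
  -- With u x = e_x and v y the signed column y of μ, the bias is ∑ μ², which is positive.
  have hle := sum_inner_le_quantumBias h hμ (u := fun x i => if i = x then 1 else 0)
    (v := fun y x => bitSign (h (x, y)) * μ (x, y)) (fun x => by simp) (fun y => by
      simp only [mul_pow, bitSign_sq, one_mul]
      refine le_trans ?_ hsq
      rw [Fintype.sum_prod_type_right]
      exact Finset.single_le_sum (f := fun y => ∑ x, μ (x, y) ^ 2)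
        (fun y _ => Finset.sum_nonneg fun x _ => sq_nonneg _) (Finset.mem_univ y))
  refine lt_of_lt_of_le ?_ hle
  have heq : ∀ p : X × Y, μ p * (bitSign (h p) * ∑ i, (if i = p.1 then (1 : ℝ) else 0) *
      (bitSign (h (i, p.2)) * μ (i, p.2))) = μ p ^ 2 := fun p => by
    simp only [ite_mul, one_mul, zero_mul, Finset.sum_ite_eq', Finset.mem_univ, if_true]
    linear_combination (μ p ^ 2) * bitSign_mul_self (h p)
  simp only [heq]
  obtain ⟨p, -, hp⟩ := Finset.exists_ne_zero_of_sum_ne_zero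
    (s := Finset.univ) (f := μ) (by rw [hμ.2]; exact one_ne_zero)
  exact Finset.sum_pos' (fun _ _ => sq_nonneg _) ⟨p, Finset.mem_univ p, by positivity⟩

/-! ### Protocols -/

lemma two_pow_add_two_pow_le (a b : ℕ) : (2 : ℝ) ^ a + 2 ^ b ≤ 2 ^ (max a b + 1) := by
  have h1 : (2 : ℝ) ^ a ≤ 2 ^ max a b := pow_le_pow_right₀ one_le_two (le_max_left _ _)
  have h2 : (2 : ℝ) ^ b ≤ 2 ^ max a b := pow_le_pow_right₀ one_le_two (le_max_right _ _)
  rw [pow_succ]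
  linarith

/-- The sign matrix of a protocol of cost `c` is the Gram matrix of vectors of length at most
`1` and vectors of length at most `2 ^ (c / 2)`. -/
lemma Protocol.exists_vectors {X Y : Type} (P : Protocol X Y) :
    ∃ (δ : Type) (_ : Fintype δ) (u : X → δ → ℝ) (v : Y → δ → ℝ),
      (∀ x, ∑ i, u x i ^ 2 ≤ 1) ∧ (∀ y, ∑ i, v y i ^ 2 ≤ 2 ^ P.cost) ∧
      ∀ x y, ∑ i, u x i * v y i = bitSign (P.run x y) := by
  induction P with
  | output b =>
    refine ⟨Unit, inferInstance, fun _ _ => 1, fun _ _ => bitSign b, ?_, ?_, ?_⟩ <;>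
      simp [bitSign_sq, cost, run]
  | alice msg P₀ P₁ ih₀ ih₁ =>
    obtain ⟨δ₀, _, u₀, v₀, hu₀, hv₀, h₀⟩ := ih₀
    obtain ⟨δ₁, _, u₁, v₁, hu₁, hv₁, h₁⟩ := ih₁
    -- Alice's vector selects the block of the child, Bob's concatenates both: his squared bounds
    -- add up, which costs a factor of at most 2.
    refine ⟨δ₀ ⊕ δ₁, inferInstance, fun x => if msg x then Sum.elim 0 (u₁ x) else
      Sum.elim (u₀ x) 0, fun y => Sum.elim (v₀ y) (v₁ y), fun x => ?_, fun y => ?_,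
      fun x y => ?_⟩
    · by_cases hm : msg x <;> simp [hm, hu₀, hu₁]
    · simp only [Fintype.sum_sum_type, Sum.elim_inl, Sum.elim_inr, cost]
      exact (add_le_add (hv₀ y) (hv₁ y)).trans (two_pow_add_two_pow_le _ _)
    · by_cases hm : msg x <;> simp [run, hm, h₀, h₁]
  | bob msg P₀ P₁ ih₀ ih₁ =>
    obtain ⟨δ₀, _, u₀, v₀, hu₀, hv₀, h₀⟩ := ih₀
    obtain ⟨δ₁, _, u₁, v₁, hu₁, hv₁, h₁⟩ := ih₁
    have h2 : (√2 : ℝ) ^ 2 = 2 := Real.sq_sqrt zero_le_two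
    have h2' : (√2 : ℝ)⁻¹ ^ 2 = 1 / 2 := by rw [inv_pow, h2, one_div]
    have h2'' (a b : ℝ) : (√2)⁻¹ * a * (√2 * b) = a * b := by
      field_simp
    -- The roles swap. The factor 1/√2 keeps Alice's concatenation in the unit ball; the
    -- compensating √2 doubles Bob's squared bound.
    refine ⟨δ₀ ⊕ δ₁, inferInstance, fun x => Sum.elim (fun i => (√2)⁻¹ * u₀ x i)
      (fun i => (√2)⁻¹ * u₁ x i), fun y => if msg y then Sum.elim 0 (fun i => √2 * v₁ y i) else
      Sum.elim (fun i => √2 * v₀ y i) 0, fun x => ?_, fun y => ?_, fun x y => ?_⟩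
    · simp only [Fintype.sum_sum_type, Sum.elim_inl, Sum.elim_inr, mul_pow, h2',
        ← Finset.mul_sum]
      linarith [hu₀ x, hu₁ x]
    · have hb : ∀ c, c ≤ max P₀.cost P₁.cost → ∀ s : ℝ, s ≤ 2 ^ c →
          2 * s ≤ 2 ^ (max P₀.cost P₁.cost + 1) := fun c hc s hs => by
        have : (2 : ℝ) ^ c ≤ 2 ^ max P₀.cost P₁.cost := pow_le_pow_right₀ one_le_two hc
        rw [pow_succ]
        linarith
      by_cases hm : msg y
      · simpa [hm, mul_pow, h2, ← Finset.mul_sum, cost] using hb _ (le_max_right _ _) _ (hv₁ y)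
      · simpa [hm, mul_pow, h2, ← Finset.mul_sum, cost] using hb _ (le_max_left _ _) _ (hv₀ y)
    · by_cases hm : msg y <;> simp [run, hm, h₀, h₁, h2'']

lemma Protocol.correlation_le {X Y : Type} [Fintype X] [Fintype Y] (P : Protocol X Y)
    (h : X × Y → Bool) {μ : X × Y → ℝ} (hμ : μ ∈ stdSimplex ℝ (X × Y)) :
    correlation (fun p => P.run p.1 p.2) h μ ≤ √(2 ^ P.cost) * quantumBias h μ := by
  obtain ⟨δ, _, u, v, hu, hv, huv⟩ := P.exists_vectors
  set r : ℝ := √(2 ^ P.cost) with hr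
  have hr0 : 0 < r := Real.sqrt_pos.mpr (by positivity)
  have hr2 : r ^ 2 = 2 ^ P.cost := Real.sq_sqrt (by positivity)
  have hle := sum_inner_le_quantumBias h hμ hu (v := fun y i => r⁻¹ * v y i) (fun y => by
    simp only [mul_pow, ← Finset.mul_sum, inv_pow, hr2]
    rw [inv_mul_le_iff₀ (by positivity), mul_one]
    exact hv y)
  refine le_trans (le_of_eq ?_) (mul_le_mul_of_nonneg_left hle hr0.le)
  rw [correlation, Finset.mul_sum]
  refine Finset.sum_congr rfl fun p _ => ?_
  have : ∑ i, u p.1 i * (r⁻¹ * v p.2 i) = r⁻¹ * bitSign (P.run p.1 p.2) := by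
    rw [← huv, Finset.mul_sum]
    exact Finset.sum_congr rfl fun i _ => by ring
  rw [this]
  field_simp

/-- Alice tests her input against each element in turn; at a match Bob sends the value. This is
needed only so that the infimum in `randomizedCC` is attained, as `sInf ∅ = 0` in `ℕ`. -/
lemma Protocol.exists_run_eq {X Y : Type} [Finite X] (f : X × Y → Bool) :
    ∃ P : Protocol X Y, ∀ x y, P.run x y = f (x, y) := by
  classical
  cases nonempty_fintype X
  suffices H : ∀ s : Finset X, ∃ P : Protocol X Y, ∀ x ∈ s, ∀ y, P.run x y = f (x, y) by
    obtain ⟨P, hP⟩ := H Finset.univ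
    exact ⟨P, fun x => hP x (Finset.mem_univ x)⟩
  intro s
  induction s using Finset.induction_on with
  | empty => exact ⟨.output false, by simp⟩
  | insert a s _ ih =>
    obtain ⟨P, hP⟩ := ih
    refine ⟨.alice (fun x => decide (x = a)) P
      (.bob (fun y => f (a, y)) (.output false) (.output true)), fun x hx y => ?_⟩
    by_cases hxa : x = a
    · subst hxa
      cases hf : f (x, y) <;> simp [run, hf]
    · simpa [run, hxa] using hP x (Finset.mem_of_mem_insert_of_ne hx hxa) y

/-! ### Averaging over the public coins -/

lemma randomizedComputable_randomizedCC {X Y : Type} [Finite X] (ε : ℝ) (f : X × Y → Bool) :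
    RandomizedComputable ε f (randomizedCC ε f) := by
  obtain ⟨P, hP⟩ := Protocol.exists_run_eq f
  refine Nat.sInf_mem (s := {k | RandomizedComputable ε f k})
    ⟨P.cost, PMF.pure P, by simp, fun x y => ?_⟩
  simp [PMF.toOuterMeasure_pure_apply, hP]

open scoped ENNReal in
/-- Averaging: if every input has error probability at most `c` then some element of the
support has weighted error at most `c` times the total weight. -/
lemma PMF.exists_mem_support_weight_le {α β : Type*} [Fintype β] (q : PMF α)
    (E : β → Set α) [∀ a b, Decidable (a ∈ E b)] {c : ℝ≥0∞}
    (hq : ∀ b, q.toOuterMeasure (E b) ≤ c) (w : β → ℝ≥0∞) (hc : c * ∑ b, w b ≠ ∞) :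
    ∃ a ∈ q.support, (∑ b, if a ∈ E b then w b else 0) ≤ c * ∑ b, w b := by
  by_contra! H
  obtain ⟨a₀, ha₀⟩ := q.support_nonempty
  have hlt : ∑' a, q a * (c * ∑ b, w b) <
      ∑' a, q a * ∑ b, if a ∈ E b then w b else 0 := by
    -- Strictness comes from one point `a₀` of the support, and needs the smaller sum to be finite.
    refine ENNReal.tsum_lt_tsum (i := a₀) ?_ (fun a => ?_) ?_
    · rw [ENNReal.tsum_mul_right, q.tsum_coe, one_mul]
      exact hc
    · by_cases ha : a ∈ q.support
      · exact mul_le_mul_right (H a ha).le _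
      · simp [(q.apply_eq_zero_iff a).mpr ha]
    · exact ENNReal.mul_lt_mul_right ((q.mem_support_iff _).mp ha₀) (q.apply_ne_top _) (H a₀ ha₀)
  rw [ENNReal.tsum_mul_right, q.tsum_coe, one_mul] at hlt
  refine hlt.not_ge ?_
  calc ∑' a, q a * ∑ b, (if a ∈ E b then w b else 0)
      = ∑' a, ∑ b, (E b).indicator q a * w b := by
        refine tsum_congr fun a => ?_
        rw [Finset.mul_sum]
        refine Finset.sum_congr rfl fun b _ => ?_
        by_cases ha : a ∈ E b <;> simp [ha]
    _ = ∑ b, q.toOuterMeasure (E b) * w b := by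
        rw [Summable.tsum_finsetSum fun _ _ => ENNReal.summable]
        refine Finset.sum_congr rfl fun b _ => ?_
        rw [ENNReal.tsum_mul_right, PMF.toOuterMeasure_apply]
    _ ≤ c * ∑ b, w b := by
        rw [Finset.mul_sum]
        exact Finset.sum_le_sum fun b _ => mul_le_mul_left (hq b) _

lemma RandomizedComputable.exists_correlation_ge {X Y : Type} [Fintype X] [Fintype Y] {ε : ℝ}
    (hε : 0 ≤ ε) {f : X × Y → Bool} {k : ℕ} (hf : RandomizedComputable ε f k)
    (h : X × Y → Bool) {μ : X × Y → ℝ} (hμ : μ ∈ stdSimplex ℝ (X × Y)) :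
    ∃ P : Protocol X Y, P.cost ≤ k ∧
      (1 - ε) * correlation f h μ - ε ≤ correlation (fun p => P.run p.1 p.2) h μ := by
  classical
  obtain ⟨q, hcost, herr⟩ := hf
  -- Only errors where f = h lower the correlation with h. That region has mass (1 + 𝔼[f h])/2, so
  -- the loss is at most ε (1 + 𝔼[f h]), whence the form of the numerator.
  let w : X × Y → ℝ := fun p => if f p = h p then μ p else 0
  have hw : ∀ p, 0 ≤ w p := fun p => by
    simp only [w]; split_ifs
    exacts [hμ.1 p, le_rfl]
  have htot : ENNReal.ofReal ε * ∑ p, ENNReal.ofReal (w p) = ENNReal.ofReal (ε * ∑ p, w p) := by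
    rw [ENNReal.ofReal_mul hε, ENNReal.ofReal_sum_of_nonneg fun p _ => hw p]
  obtain ⟨P, hP, hle⟩ := q.exists_mem_support_weight_le
    (fun p : X × Y => {P : Protocol X Y | P.run p.1 p.2 ≠ f p}) (fun p => herr p.1 p.2)
    (fun p => ENNReal.ofReal (w p)) (by rw [htot]; exact ENNReal.ofReal_ne_top)
  refine ⟨P, hcost P hP, ?_⟩
  have hle' : (∑ p : X × Y, if P.run p.1 p.2 ≠ f p then w p else 0) ≤ ε * ∑ p, w p := by
    rw [htot] at hle
    refine (ENNReal.ofReal_le_ofReal_iff (mul_nonneg hε (Finset.sum_nonneg fun p _ => hw p))).mp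
      (le_trans (le_of_eq ?_) hle)
    rw [ENNReal.ofReal_sum_of_nonneg fun p _ => by
      split_ifs
      exacts [hw p, le_rfl]]
    refine Finset.sum_congr rfl fun p _ => ?_
    by_cases hp : P.run p.1 p.2 = f p <;> simp [hp]
  have hcorr : 2 * ∑ p, w p = 1 + correlation f h μ := by
    rw [← hμ.2, correlation, Finset.mul_sum, ← Finset.sum_add_distrib]
    refine Finset.sum_congr rfl fun p _ => ?_
    cases hfp : f p <;> cases hhp : h p <;> simp [w, hfp, hhp, bitSign] <;> ring
  have hcorrP : correlation f h μ - 2 * (∑ p : X × Y, if P.run p.1 p.2 ≠ f p then w p else 0) ≤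
      correlation (fun p => P.run p.1 p.2) h μ := by
    rw [correlation, correlation, Finset.mul_sum, ← Finset.sum_sub_distrib]
    refine Finset.sum_le_sum fun p _ => ?_
    have h0 := hμ.1 p
    cases hfp : f p <;> cases hhp : h p <;> cases hPp : P.run p.1 p.2 <;>
      simp [w, hfp, hhp, bitSign] <;> linarith
  nlinarith

/-! ### The lower bound -/

theorem theorem2 (n : ℕ) (f : Bits n × Bits n → Bool) (ε : ℝ) (hε : ε ∈ Set.Icc (0 : ℝ) (1 / 2)) :
    (∀ h : Bits n × Bits n → Bool, ∀ μ ∈ stdSimplex ℝ (Bits n × Bits n),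
      0 < quantumBias h μ) ∧
    ∃ m : ℝ,
      IsGreatest {v : ℝ | ∃ h : Bits n × Bits n → Bool, ∃ μ ∈ stdSimplex ℝ (Bits n × Bits n),
        v = ((1 - ε) * correlation f h μ - ε) / quantumBias h μ} m ∧
      (ε < 1 / 2 → 0 < m) ∧
      2 * Real.logb 2 m ≤ (randomizedCC ε f : ℝ) := by
  refine ⟨fun h μ hμ => quantumBias_pos h hμ, ?_⟩
  obtain ⟨μ₀, hμ₀⟩ : (stdSimplex ℝ (Bits n × Bits n)).Nonempty :=
    ⟨_, single_mem_stdSimplex ℝ (default : Bits n × Bits n)⟩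
  set V : Set ℝ := {v : ℝ | ∃ h : Bits n × Bits n → Bool,
    ∃ μ ∈ stdSimplex ℝ (Bits n × Bits n),
      v = ((1 - ε) * correlation f h μ - ε) / quantumBias h μ} with hV
  have hmem : (1 - 2 * ε) / quantumBias f μ₀ ∈ V :=
    ⟨f, μ₀, hμ₀, by rw [correlation_self f hμ₀]; ring⟩
  have hcomp : IsCompact V := by
    have hVeq : V = ⋃ h : Bits n × Bits n → Bool,
        (fun μ => ((1 - ε) * correlation f h μ - ε) / quantumBias h μ) ''
          stdSimplex ℝ (Bits n × Bits n) := by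
      ext v
      simp [hV, eq_comm]
    rw [hVeq]
    refine isCompact_iUnion fun h => (isCompact_stdSimplex ℝ _).image_of_continuousOn ?_
    refine ContinuousOn.div ?_ (continuousOn_quantumBias h) fun μ hμ => (quantumBias_pos h hμ).ne'
    unfold correlation
    fun_prop
  obtain ⟨m, hm⟩ := hcomp.exists_isGreatest ⟨_, hmem⟩
  have hβ := quantumBias_pos f hμ₀
  refine ⟨m, hm, fun hlt => (div_pos (by linarith) hβ).trans_le (hm.2 hmem), ?_⟩
  have hm0 : 0 ≤ m := (div_nonneg (by linarith [hε.2]) hβ.le).trans (hm.2 hmem)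
  rcases hm0.eq_or_lt with rfl | hm0
  -- For m = 0 the convention `Real.logb 2 0 = 0` makes the bound trivial.
  · simp
  obtain ⟨h, μ, hμ, hmeq⟩ := hm.1
  obtain ⟨P, hcost, hP⟩ :=
    (randomizedComputable_randomizedCC ε f).exists_correlation_ge hε.1 h hμ
  have hle : m ≤ √(2 ^ P.cost) := by
    rw [hmeq, div_le_iff₀ (quantumBias_pos h hμ)]
    exact hP.trans (P.correlation_le h hμ)
  have hsq : m ^ 2 ≤ 2 ^ P.cost := (Real.le_sqrt hm0.le (by positivity)).mp hle
  calc 2 * Real.logb 2 m = Real.logb 2 (m ^ 2) := by rw [Real.logb_pow]; norm_num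
    _ ≤ Real.logb 2 (2 ^ P.cost) := Real.logb_le_logb_of_le one_lt_two (by positivity) hsq
    _ = P.cost := by rw [Real.logb_pow, Real.logb_self_eq_one one_lt_two, mul_one]
    _ ≤ randomizedCC ε f := by exact_mod_cast hcost
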